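/- Let $\mathbb K\in\{\mathbb R,\mathbb C\}$, let $\Gamma$ be an arbitrary set, and let $\ell_\infty(\Gamma)$ be the Banach space of bounded functions $\Gamma\to\mathbb K$ with the supremum norm. Let $Y$ be a quotient of $\ell_\infty(\Gamma)$, that is, a normed space linearly isometric to $\ell_\infty(\Gamma)/M$ with the quotient norm, for some closed linear subspace $M$ of $\ell_\infty(\Gamma)$. Then $Y$ is $1$-Grothendieck: for every bounded sequence $(y^*_n)_{n\in\mathbb N}$ in the dual space $Y^*$, $$\sup_{y^{**}\in B_{Y^{**}}}\ \inf_{n\in\mathbb N}\ \sup_{k,l\ge n}\ |y^{**}(y^*_k)-y^{**}(y^*_l)|\ \le\ \sup_{y\in B_Y}\ \inf_{n\in\mathbb N}\ \sup_{k,l\ge n}\ |y^*_k(y)-y^*_l(y)|,$$ where $B_Y$ and $B_{Y^{**}}$ denote the closed unit balls of $Y$ and of its bidual $Y^{**}$. -/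

import Mathlib

open scoped ENNReal NNReal lp

/-- The Cauchy oscillation `inf_n sup_{k, l ≥ n} |a_k - a_l|` of a scalar sequence, computed
in `[0, ∞]`; for a bounded sequence it is the usual real number. -/
noncomputable def cauchyOsc {𝕜 : Type*} [RCLike 𝕜] (a : ℕ → 𝕜) : ℝ≥0∞ :=
  ⨅ n : ℕ, ⨆ k ≥ n, ⨆ l ≥ n, ‖a k - a l‖ₑ

/-- The measure of weak non-Cauchyness `δ_w` of a sequence in the dual `X^*`: the supremum of the
Cauchy oscillations of `x^{**}(x^*_n)` over the closed unit ball of the bidual. -/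
noncomputable def deltaW (𝕜 : Type*) [RCLike 𝕜] (X : Type*) [NormedAddCommGroup X]
    [NormedSpace 𝕜 X] (f : ℕ → StrongDual 𝕜 X) : ℝ≥0∞ :=
  ⨆ φ ∈ Metric.closedBall (0 : StrongDual 𝕜 (StrongDual 𝕜 X)) 1, cauchyOsc fun n => φ (f n)

/-- The measure of weak-star non-Cauchyness `δ_{w^*}` of a sequence in the dual `X^*`: the supremum
of the Cauchy oscillations of `x^*_n(x)` over the closed unit ball of `X`. -/
noncomputable def deltaWStar (𝕜 : Type*) [RCLike 𝕜] (X : Type*) [NormedAddCommGroup X]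
    [NormedSpace 𝕜 X] (f : ℕ → StrongDual 𝕜 X) : ℝ≥0∞ :=
  ⨆ x ∈ Metric.closedBall (0 : X) 1, cauchyOsc fun n => f n x

/-- `X` is `c`-Grothendieck (used for `c ≥ 1`): `δ_w ≤ c δ_{w^*}` for every norm-bounded
sequence in the dual. -/
def IsQuantGrothendieck (𝕜 : Type*) [RCLike 𝕜] (c : ℝ≥0) (X : Type*) [NormedAddCommGroup X]
    [NormedSpace 𝕜 X] : Prop :=
  ∀ f : ℕ → StrongDual 𝕜 X, (∃ C : ℝ, ∀ n, ‖f n‖ ≤ C) →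
    deltaW 𝕜 X f ≤ (c : ℝ≥0∞) * deltaWStar 𝕜 X f

/-- `Y` is a quotient of `X`: it is linearly isometric to `X ⧸ M`, with the quotient norm, for
some closed subspace `M` of `X`. -/
def IsQuotientSpaceOf (𝕜 : Type*) [RCLike 𝕜] (Y X : Type*) [NormedAddCommGroup Y]
    [NormedSpace 𝕜 Y] [NormedAddCommGroup X] [NormedSpace 𝕜 X] : Prop :=
  ∃ M : Submodule 𝕜 X, IsClosed (M : Set X) ∧ Nonempty ((X ⧸ M) ≃ₗᵢ[𝕜] Y)

/-! The property passes to quotients, because the adjoint of a quotient map is an isometric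
embedding and bidual functionals extend along it. So it suffices to treat ℓ_∞(Γ) = C(βΓ), with βΓ
realised as `Ultrafilter Γ`. If φ in the bidual ball sees oscillation above r, then differences ν_j
of far terms satisfy Re φ(ν_j) ≥ c > r along an ultrafilter, after a rotation. What is needed is one
x in the unit ball with Re ν_j(x) ≥ c - 21ε for infinitely many j (`exists_frequently_le_re_apply`).

All ν_j have densities g_j with respect to one finite regular measure μ. There are M and b such that
the mass of g_j above level M is at most b + ε, while above every level L it stays at least b - ε,
eventually along the ultrafilter. The parts of g_j below M converge weakly in L²(μ); φ nearly
attains c - b on the limit, hence so does a continuous f. The tails have nearly all their mass on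
sets of tiny μ-measure, so they are almost normed by functions s_j that are large only on tiny
clopen sets.

A Rosenthal-type argument makes these sets disjoint along a subsequence, with the closure of their
union still small. Bounded functions on disjoint subsets of Γ glue, so x can be s_j on the j-th set
and f off the union. The tails then give b, the bounded parts give c - b, and the constant is 1. -/

open MeasureTheory Filter CompactlySupported
open scoped Topology

/-! ### The modulus of a functional on C(K) -/

section Modulus

variable {𝕜 : Type*} [RCLike 𝕜] {K : Type*} [TopologicalSpace K]

/-- The modulus `|ν|` of a functional on `C(K, 𝕜)`, evaluated at a nonnegative function. -/
noncomputable def dualModulus (ν : StrongDual 𝕜 C(K, 𝕜)) (f : C(K, ℝ≥0)) : ℝ≥0 :=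
  ⨆ y : {y : C(K, 𝕜) // ∀ x, ‖y x‖₊ ≤ f x}, ‖ν y‖₊

theorem dualModulus_le (ν : StrongDual 𝕜 C(K, 𝕜)) {f : C(K, ℝ≥0)} {a : ℝ≥0}
    (h : ∀ y : C(K, 𝕜), (∀ x, ‖y x‖₊ ≤ f x) → ‖ν y‖₊ ≤ a) : dualModulus ν f ≤ a :=
  ciSup_le' fun y => h y y.2

variable [CompactSpace K]

theorem nnnorm_apply_le_of_dominated (ν : StrongDual 𝕜 C(K, 𝕜)) {f : C(K, ℝ≥0)} {B : ℝ≥0}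
    (hB : ∀ x, f x ≤ B) {y : C(K, 𝕜)} (hy : ∀ x, ‖y x‖₊ ≤ f x) : ‖ν y‖₊ ≤ ‖ν‖₊ * B := by
  refine (ν.le_opNNNorm y).trans ?_
  gcongr
  rw [← NNReal.coe_le_coe, coe_nnnorm]
  exact (ContinuousMap.norm_le _ B.2).2 fun x => NNReal.coe_le_coe.2 ((hy x).trans (hB x))

theorem ContinuousMap.exists_nnreal_bound (f : C(K, ℝ≥0)) : ∃ B : ℝ≥0, ∀ x, f x ≤ B := by
  obtain ⟨B, hB⟩ := (isCompact_range f.continuous).bddAbove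
  exact ⟨B, fun x => hB ⟨x, rfl⟩⟩

theorem dualModulus_bddAbove (ν : StrongDual 𝕜 C(K, 𝕜)) (f : C(K, ℝ≥0)) :
    BddAbove (Set.range fun y : {y : C(K, 𝕜) // ∀ x, ‖y x‖₊ ≤ f x} => ‖ν y‖₊) := by
  obtain ⟨B, hB⟩ := f.exists_nnreal_bound
  exact ⟨‖ν‖₊ * B, by rintro _ ⟨y, rfl⟩; exact nnnorm_apply_le_of_dominated ν hB y.2⟩

theorem le_dualModulus (ν : StrongDual 𝕜 C(K, 𝕜)) {f : C(K, ℝ≥0)} {y : C(K, 𝕜)}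
    (hy : ∀ x, ‖y x‖₊ ≤ f x) : ‖ν y‖₊ ≤ dualModulus ν f :=
  le_ciSup (dualModulus_bddAbove ν f) ⟨y, hy⟩

theorem dualModulus_smul_le (ν : StrongDual 𝕜 C(K, 𝕜)) (c : ℝ≥0) (f : C(K, ℝ≥0)) :
    dualModulus ν (c • f) ≤ c * dualModulus ν f := by
  refine dualModulus_le ν fun y hy => ?_
  rcases eq_or_ne c 0 with rfl | hc
  · have : y = 0 := by
      ext x
      simpa using hy x
    simp [this]
  · have h := le_dualModulus ν (f := f) (y := ((c⁻¹ : ℝ≥0) : ℝ) • y) fun x => by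
      have := hy x
      simp only [ContinuousMap.smul_apply, nnnorm_smul, smul_eq_mul] at this ⊢
      simp only [Real.nnnorm_of_nonneg (NNReal.coe_nonneg _)]
      calc _ ≤ c⁻¹ * (c * f x) := by gcongr; rfl
        _ = f x := inv_mul_cancel_left₀ hc _
    have h2 : y = (c : ℝ) • ((c⁻¹ : ℝ≥0) : ℝ) • y := by
      rw [smul_smul]; simp [hc]
    rw [h2]
    have h3 : ∀ (r : ℝ) (z : C(K, 𝕜)), ν (r • z) = r • ν z := fun r z => by
      rw [RCLike.real_smul_eq_coe_smul (K := 𝕜), RCLike.real_smul_eq_coe_smul (K := 𝕜), map_smul]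
    rw [h3, nnnorm_smul, Real.nnnorm_of_nonneg (NNReal.coe_nonneg _)]
    gcongr
    rfl

theorem dualModulus_smul (ν : StrongDual 𝕜 C(K, 𝕜)) (c : ℝ≥0) (f : C(K, ℝ≥0)) :
    dualModulus ν (c • f) = c * dualModulus ν f := by
  refine le_antisymm (dualModulus_smul_le ν c f) ?_
  rcases eq_or_ne c 0 with rfl | hc
  · simp
  · calc c * dualModulus ν f = c * dualModulus ν (c⁻¹ • c • f) := by rw [inv_smul_smul₀ hc]
      _ ≤ c * (c⁻¹ * dualModulus ν (c • f)) := by gcongr; exact dualModulus_smul_le ν _ _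
      _ = _ := mul_inv_cancel_left₀ hc _

/-- Separate unimodular rotations of y and z make ν y and ν z nonnegative, so their absolute values
add. -/
theorem add_le_dualModulus_add (ν : StrongDual 𝕜 C(K, 𝕜)) (f g : C(K, ℝ≥0)) :
    dualModulus ν f + dualModulus ν g ≤ dualModulus ν (f + g) := by
  have key : ∀ y z : C(K, 𝕜), (∀ x, ‖y x‖₊ ≤ f x) → (∀ x, ‖z x‖₊ ≤ g x) →
      ‖ν y‖₊ + ‖ν z‖₊ ≤ dualModulus ν (f + g) := by
    intro y z hy hz
    obtain ⟨a, ha, ha'⟩ := RCLike.exists_norm_eq_mul_self (ν y)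
    obtain ⟨b, hb, hb'⟩ := RCLike.exists_norm_eq_mul_self (ν z)
    have ha1 : ‖a‖₊ = 1 := by ext; simpa using ha
    have hb1 : ‖b‖₊ = 1 := by ext; simpa using hb
    have h := le_dualModulus ν (f := f + g) (y := a • y + b • z) fun x => by
      refine (nnnorm_add_le _ _).trans ?_
      simp only [ContinuousMap.smul_apply, nnnorm_smul, ContinuousMap.add_apply, ha1, hb1, one_mul]
      exact add_le_add (hy x) (hz x)
    refine le_trans (le_of_eq ?_) h
    rw [map_add, map_smul, map_smul, smul_eq_mul, smul_eq_mul, ← ha', ← hb', ← RCLike.ofReal_add]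
    ext
    rw [coe_nnnorm, RCLike.norm_ofReal,
      abs_of_nonneg (add_nonneg (norm_nonneg (ν y)) (norm_nonneg (ν z)))]
    rfl
  have h1 : ∀ z : C(K, 𝕜), (∀ x, ‖z x‖₊ ≤ g x) →
      dualModulus ν f ≤ dualModulus ν (f + g) - ‖ν z‖₊ := fun z hz =>
    dualModulus_le ν fun y hy => le_tsub_of_add_le_right (key y z hy hz)
  have h0 : dualModulus ν f ≤ dualModulus ν (f + g) := by
    simpa using h1 0 (fun x => by simp)
  have h2 : dualModulus ν g ≤ dualModulus ν (f + g) - dualModulus ν f := by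
    refine dualModulus_le ν fun z hz => ?_
    have h3 := h1 z hz
    have h4 : ‖ν z‖₊ ≤ dualModulus ν (f + g) := by
      simpa using key 0 z (fun x => by simp) hz
    rw [le_tsub_iff_right h4] at h3
    exact le_tsub_of_add_le_left h3
  rw [add_comm]
  exact (le_tsub_iff_right h0).1 h2

/-- Riesz decomposition: y is split in the proportions f : g : δ. The constant δ keeps the quotients
continuous where f + g vanishes, and costs at most ‖ν‖δ. -/
theorem dualModulus_add_le (ν : StrongDual 𝕜 C(K, 𝕜)) (f g : C(K, ℝ≥0)) :
    dualModulus ν (f + g) ≤ dualModulus ν f + dualModulus ν g := by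
  refine dualModulus_le ν fun y hy => ?_
  refine le_of_forall_pos_le_add fun ε hε => ?_
  obtain ⟨δ, hδ, hδε⟩ : ∃ δ : ℝ≥0, 0 < δ ∧ ‖ν‖₊ * δ ≤ ε := by
    refine ⟨ε / (‖ν‖₊ + 1), by positivity, ?_⟩
    rw [mul_div_assoc', div_le_iff₀ (by positivity), mul_comm]
    gcongr
    simp
  have hpos : ∀ x, f x + g x + δ ≠ 0 := fun x => by positivity
  have hcont : Continuous fun x => (f x + g x + δ)⁻¹ :=
    Continuous.inv₀ (by fun_prop) hpos
  have part : ∀ k : C(K, ℝ≥0), (∀ x, ‖y x‖₊ ≤ f x + g x) →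
      ∃ z : C(K, 𝕜), (∀ x, z x = (((k x * (f x + g x + δ)⁻¹ : ℝ≥0) : ℝ) : 𝕜) * y x) ∧
        ∀ x, ‖z x‖₊ ≤ k x := by
    intro k hy
    refine ⟨⟨fun x => (((k x * (f x + g x + δ)⁻¹ : ℝ≥0) : ℝ) : 𝕜) * y x, ?_⟩, fun x => rfl, ?_⟩
    · have : Continuous fun x => k x * (f x + g x + δ)⁻¹ := by fun_prop
      exact (RCLike.continuous_ofReal.comp (NNReal.continuous_coe.comp this)).mul y.continuous
    · intro x
      have hn : ∀ r : ℝ≥0, ‖((r : ℝ) : 𝕜)‖₊ = r := fun r => by ext; simp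
      change ‖(((k x * (f x + g x + δ)⁻¹ : ℝ≥0) : ℝ) : 𝕜) * y x‖₊ ≤ k x
      rw [nnnorm_mul, hn, mul_assoc]
      refine mul_le_of_le_one_right' ?_
      rw [mul_comm, ← div_eq_mul_inv]
      refine div_le_one_of_le₀ ((hy x).trans ?_) zero_le
      simp
  obtain ⟨y₁, h₁, h₁'⟩ := part f hy
  obtain ⟨y₂, h₂, h₂'⟩ := part g hy
  obtain ⟨y₃, h₃, h₃'⟩ := part (.const K δ) hy
  have hsum : y = y₁ + y₂ + y₃ := by
    ext x
    simp only [ContinuousMap.add_apply, h₁, h₂, h₃, ContinuousMap.const_apply]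
    rw [← add_mul, ← add_mul, ← RCLike.ofReal_add, ← RCLike.ofReal_add, ← NNReal.coe_add,
      ← NNReal.coe_add, ← add_mul, ← add_mul, mul_inv_cancel₀ (hpos x)]
    simp
  rw [hsum, map_add, map_add]
  refine (nnnorm_add_le _ _).trans (add_le_add ((nnnorm_add_le _ _).trans (add_le_add ?_ ?_)) ?_)
  · exact le_dualModulus ν h₁'
  · exact le_dualModulus ν h₂'
  · exact (nnnorm_apply_le_of_dominated ν (fun x => le_rfl) h₃').trans hδε

theorem dualModulus_add (ν : StrongDual 𝕜 C(K, 𝕜)) (f g : C(K, ℝ≥0)) :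
    dualModulus ν (f + g) = dualModulus ν f + dualModulus ν g :=
  le_antisymm (dualModulus_add_le ν f g) (add_le_dualModulus_add ν f g)

end Modulus

section Hoelder

variable {α 𝕜 : Type*} [RCLike 𝕜] {m : MeasurableSpace α} {μ : Measure α}

theorem integral_norm_mul_norm_le_eLpNorm_two {f g : α → 𝕜} (hf : MemLp f 2 μ)
    (hg : MemLp g 2 μ) :
    ∫ x, ‖f x‖ * ‖g x‖ ∂μ ≤ (eLpNorm f 2 μ).toReal * (eLpNorm g 2 μ).toReal := by
  have h := real_inner_le_norm (hf.norm.toLp _) (hg.norm.toLp _)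
  rw [Lp.norm_toLp, Lp.norm_toLp, eLpNorm_norm, eLpNorm_norm, L2.inner_def] at h
  refine le_trans (le_of_eq ?_) h
  refine integral_congr_ae ?_
  filter_upwards [hf.norm.coeFn_toLp, hg.norm.coeFn_toLp] with x h1 h2
  rw [h1, h2]
  simp [mul_comm]

end Hoelder

/-! ### A common measure and L² densities -/

section Riesz

variable {𝕜 : Type*} [RCLike 𝕜] {K : Type*} [TopologicalSpace K] [CompactSpace K]
  [MeasurableSpace K] [BorelSpace K]

/-- A bounded sequence in the dual of `C(K, 𝕜)` is controlled by a single regular measure. -/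
theorem exists_regular_measure_dominating [T2Space K] (ν : ℕ → StrongDual 𝕜 C(K, 𝕜)) {C : ℝ≥0}
    (hC : ∀ n, ‖ν n‖₊ ≤ C) :
    ∃ μ : Measure K, IsFiniteMeasure μ ∧ μ.Regular ∧
      ∀ n, ∃ B : ℝ≥0, ∀ f : C(K, 𝕜), ‖ν n f‖ ≤ B * ∫ x, ‖f x‖ ∂μ := by
  obtain ⟨w, hw0, hw⟩ : ∃ w : ℕ → ℝ≥0, (∀ n, w n ≠ 0) ∧ Summable w :=
    ⟨fun n => 2⁻¹ ^ n, fun n => by positivity, NNReal.summable_geometric (by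
      rw [← NNReal.coe_lt_coe]; norm_num)⟩
  have hsum : ∀ f : C(K, ℝ≥0), Summable fun n => w n * dualModulus (ν n) f := by
    intro f
    obtain ⟨B, hB⟩ := f.exists_nnreal_bound
    refine NNReal.summable_of_le (f := fun n => w n * (C * B)) (fun n => ?_) (hw.mul_right _)
    refine mul_le_mul_right ?_ (w n)
    refine dualModulus_le _ fun y hy => (nnnorm_apply_le_of_dominated (ν n) hB hy).trans ?_
    gcongr
    exact hC n
  -- The weighted sum of the moduli |ν_n| is additive, so Riesz–Markov represents it by a measure
  -- that dominates each ν_n up to the factor 1 / w n.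
  let Λ : C_c(K, ℝ≥0) →ₗ[ℝ≥0] ℝ≥0 :=
    { toFun := fun f => ∑' n, w n * dualModulus (ν n) f.toContinuousMap
      map_add' := fun f g => by
        rw [← (hsum _).tsum_add (hsum _)]
        refine tsum_congr fun n => ?_
        rw [← mul_add, ← dualModulus_add]
        rfl
      map_smul' := fun c f => by
        rw [RingHom.id_apply, smul_eq_mul, ← NNReal.tsum_mul_left]
        refine tsum_congr fun n => ?_
        have h := dualModulus_smul (ν n) c f.toContinuousMap
        rw [mul_left_comm, ← h]
        rfl }
  have hfin : IsFiniteMeasure (NNRealRMK.rieszMeasure Λ) :=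
    ⟨isCompact_univ.measure_lt_top⟩
  refine ⟨NNRealRMK.rieszMeasure Λ, hfin, inferInstance, fun n => ⟨(w n)⁻¹, fun f => ?_⟩⟩
  let F : C_c(K, ℝ≥0) := ⟨⟨fun x => ‖f x‖₊, by fun_prop⟩, HasCompactSupport.of_compactSpace _⟩
  have h1 : ‖ν n f‖₊ ≤ dualModulus (ν n) F.toContinuousMap :=
    le_dualModulus _ fun x => le_rfl
  have h2 : w n * dualModulus (ν n) F.toContinuousMap ≤ Λ F :=
    (hsum F.toContinuousMap).le_tsum n (fun _ _ => zero_le)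
  have h3 : ‖ν n f‖₊ ≤ (w n)⁻¹ * Λ F := by
    refine h1.trans ?_
    calc dualModulus (ν n) F.toContinuousMap
        = (w n)⁻¹ * (w n * dualModulus (ν n) F.toContinuousMap) := by
          rw [inv_mul_cancel_left₀ (hw0 n)]
      _ ≤ _ := by gcongr
  have h4 := NNRealRMK.integral_rieszMeasure Λ F
  calc ‖ν n f‖ ≤ ((w n)⁻¹ : ℝ≥0) * (Λ F : ℝ) := NNReal.coe_le_coe.2 h3
    _ = _ := by rw [← h4]; rfl

variable (μ : Measure K) [IsFiniteMeasure μ]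

theorem ContinuousMap.memLp_two (f : C(K, 𝕜)) : MemLp f 2 μ :=
  (Lp.memLp (ContinuousMap.toLp 2 μ 𝕜 f)).ae_eq (ContinuousMap.coeFn_toLp μ f)

theorem eLpNorm_continuousMap_eq_norm_toLp (f : C(K, 𝕜)) :
    (eLpNorm f 2 μ).toReal = ‖ContinuousMap.toLp 2 μ 𝕜 f‖ := by
  rw [Lp.norm_def, eLpNorm_congr_ae (ContinuousMap.coeFn_toLp μ f)]

/-- The functional `f ↦ ∫ f h dμ` on `C(K, 𝕜)`, as a linear function of `h ∈ L²(μ)`. -/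
noncomputable def lpDensity : Lp 𝕜 2 μ →L[𝕜] StrongDual 𝕜 C(K, 𝕜) :=
  LinearMap.mkContinuous₂
    (LinearMap.mk₂ 𝕜 (fun (h : Lp 𝕜 2 μ) (f : C(K, 𝕜)) =>
        inner 𝕜 (ContinuousMap.toLp 2 μ 𝕜 (star f)) h)
      (fun h h' f => inner_add_right (𝕜 := 𝕜) (ContinuousMap.toLp (E := 𝕜) 2 μ 𝕜 (star f)) h h')
      (fun c h f => inner_smul_right (ContinuousMap.toLp (E := 𝕜) 2 μ 𝕜 (star f)) h c)
      (fun h f g => by simp only [star_add, map_add, inner_add_left])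
      (fun c h f => by
        simp only [star_smul, map_smul, inner_smul_left, smul_eq_mul]; simp))
    ‖ContinuousMap.toLp (E := 𝕜) 2 μ 𝕜‖
    (fun h f => by
      refine (norm_inner_le_norm (𝕜 := 𝕜) (ContinuousMap.toLp (E := 𝕜) 2 μ 𝕜 (star f)) h).trans ?_
      rw [mul_right_comm]
      gcongr
      simpa using (ContinuousMap.toLp (E := 𝕜) 2 μ 𝕜).le_opNorm (star f))

theorem lpDensity_apply_eq_inner (h : Lp 𝕜 2 μ) (f : C(K, 𝕜)) :
    lpDensity μ h f = inner 𝕜 (ContinuousMap.toLp 2 μ 𝕜 (star f)) h := rfl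

theorem lpDensity_apply (h : Lp 𝕜 2 μ) (f : C(K, 𝕜)) :
    lpDensity μ h f = ∫ x, f x * h x ∂μ := by
  rw [lpDensity_apply_eq_inner, L2.inner_def]
  refine integral_congr_ae ?_
  filter_upwards [ContinuousMap.coeFn_toLp (p := 2) (𝕜 := 𝕜) μ (star f)] with x hx
  rw [hx]
  simp [mul_comm]

/-- Since μ is finite, the L¹ bound is also an L² bound. So ν extends to L²(μ) by density and is
represented by a vector, conjugated because the inner product is conjugate-linear there. -/
theorem exists_lpDensity_eq [T2Space K] [μ.Regular] (ν : StrongDual 𝕜 C(K, 𝕜)) {B : ℝ≥0}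
    (hB : ∀ f : C(K, 𝕜), ‖ν f‖ ≤ B * ∫ x, ‖f x‖ ∂μ) : ∃ g : Lp 𝕜 2 μ, lpDensity μ g = ν := by
  have hd : DenseRange (ContinuousMap.toLp (E := 𝕜) 2 μ 𝕜) :=
    ContinuousMap.toLp_denseRange 𝕜 μ 𝕜 (by simp)
  have hb : ∃ D, ∀ f : C(K, 𝕜), ‖ν f‖ ≤ D * ‖ContinuousMap.toLp 2 μ 𝕜 f‖ := by
    refine ⟨B * (eLpNorm (1 : C(K, 𝕜)) 2 μ).toReal, fun f => (hB f).trans ?_⟩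
    have := integral_norm_mul_norm_le_eLpNorm_two ((1 : C(K, 𝕜)).memLp_two μ) (f.memLp_two μ)
    rw [mul_assoc, ← eLpNorm_continuousMap_eq_norm_toLp]
    gcongr
    simpa using this
  let T : StrongDual 𝕜 (Lp 𝕜 2 μ) :=
    LinearMap.extendOfNorm ν.toLinearMap (ContinuousMap.toLp (E := 𝕜) 2 μ 𝕜).toLinearMap
  have hT : ∀ f : C(K, 𝕜), T (ContinuousMap.toLp 2 μ 𝕜 f) = ν f := fun f =>
    LinearMap.extendOfNorm_eq (f := ν.toLinearMap)
      (e := (ContinuousMap.toLp (E := 𝕜) 2 μ 𝕜).toLinearMap) hd hb f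
  let g₀ := (InnerProductSpace.toDual 𝕜 (Lp 𝕜 2 μ)).symm T
  refine ⟨star g₀, ?_⟩
  ext f
  rw [lpDensity_apply, ← hT f, ← InnerProductSpace.toDual_symm_apply, L2.inner_def]
  refine integral_congr_ae ?_
  filter_upwards [ContinuousMap.coeFn_toLp (p := 2) (𝕜 := 𝕜) μ f, Lp.coeFn_star g₀] with x h1 h2
  rw [h1, h2]
  simp [g₀]

end Riesz

/-! ### Disjointification for finitely additive masses -/

section Masses

variable {Γ : Type*}

/-- A nonnegative finitely additive function on the power set of `Γ`. -/
structure IsFinitelyAdditive (τ : Set Γ → ℝ) : Prop where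
  nonneg : ∀ A, 0 ≤ τ A
  union : ∀ A B, Disjoint A B → τ (A ∪ B) = τ A + τ B

namespace IsFinitelyAdditive

variable {τ : Set Γ → ℝ} (h : IsFinitelyAdditive τ)
include h

theorem empty : τ ∅ = 0 := by
  have := h.union ∅ ∅ (by simp)
  simp only [Set.union_self] at this
  linarith

theorem mono {A B : Set Γ} (hAB : A ⊆ B) : τ A ≤ τ B := by
  rw [← Set.union_sdiff_cancel hAB, h.union _ _ Set.disjoint_sdiff_right]
  linarith [h.nonneg (B \ A)]

theorem union_le (A B : Set Γ) : τ (A ∪ B) ≤ τ A + τ B := by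
  rw [← Set.union_sdiff_self, h.union _ _ Set.disjoint_sdiff_right]
  linarith [h.mono (Set.sdiff_subset : B \ A ⊆ B)]

theorem biUnion_le {ι : Type*} (F : Finset ι) (A : ι → Set Γ) :
    τ (⋃ i ∈ F, A i) ≤ ∑ i ∈ F, τ (A i) := by
  classical
  induction F using Finset.induction_on with
  | empty => simp [h.empty]
  | insert a F ha ih =>
    rw [Finset.set_biUnion_insert, Finset.sum_insert ha]
    exact (h.union_le _ _).trans (by linarith)

theorem sum_le_of_pairwise_disjoint {ι : Type*} (F : Finset ι) (A : ι → Set Γ)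
    (hA : ∀ i ∈ F, ∀ j ∈ F, i ≠ j → Disjoint (A i) (A j)) :
    ∑ i ∈ F, τ (A i) ≤ τ Set.univ := by
  classical
  suffices H : ∑ i ∈ F, τ (A i) = τ (⋃ i ∈ F, A i) from H ▸ h.mono (Set.subset_univ _)
  induction F using Finset.induction_on with
  | empty => simp [h.empty]
  | insert a F ha ih =>
    rw [Finset.set_biUnion_insert, Finset.sum_insert ha, h.union, ih]
    · exact fun i hi j hj => hA i (Finset.mem_insert_of_mem hi) j (Finset.mem_insert_of_mem hj)
    · refine Set.disjoint_iUnion₂_right.2 fun i hi => ?_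
      exact hA a (Finset.mem_insert_self _ _) i (Finset.mem_insert_of_mem hi)
        (fun e => ha (e ▸ hi))

end IsFinitelyAdditive

variable {τ : ℕ → Set Γ → ℝ} (hτ : ∀ i, IsFinitelyAdditive (τ i)) {C : ℝ}
  (hC : ∀ i, τ i Set.univ ≤ C) {A : ℕ → Set Γ} {w : ℕ → ℝ} (hw0 : ∀ i, 0 < w i) {η : ℝ}
  (hw : ∀ F : Finset ℕ, ∑ i ∈ F, w i ≤ η) (hA : ∀ i j, i < j → τ i (A j) ≤ w j)
include hτ hC hw hA

/-- Take N > C / δ indices in S and remove from each A a the later chosen sets, which costs at most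
η. If every remainder had mass at least δ along the ultrafilter, a single τ i would give N disjoint
sets mass at least δ each, exceeding C. -/
theorem exists_large_subset_eventually_small {S : Set ℕ} (hS : S ∈ hyperfilter ℕ) {δ : ℝ}
    (hδ : 0 < δ) :
    ∃ a ∈ S, ∃ D ⊆ A a, τ a (A a \ D) ≤ η ∧ ∀ᶠ i in (hyperfilter ℕ : Filter ℕ), τ i D < δ := by
  classical
  obtain ⟨N, hN⟩ := exists_nat_gt (C / δ)
  rw [div_lt_iff₀ hδ] at hN
  have hinf : S.Infinite := fun hfin => Set.Finite.notMem_hyperfilter hfin hS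
  obtain ⟨F, hFS, hFN⟩ := hinf.exists_subset_card_eq N
  let D : ℕ → Set Γ := fun a => A a \ ⋃ b ∈ F.filter (a < ·), A b
  by_contra! hcon
  have hlarge : ∀ a ∈ F, ∀ᶠ i in (hyperfilter ℕ : Filter ℕ), δ ≤ τ i (D a) := by
    intro a ha
    have h1 := hcon a (hFS ha) (D a) Set.sdiff_subset ?_
    · exact h1
    · calc τ a (A a \ D a) ≤ τ a (⋃ b ∈ F.filter (a < ·), A b) :=
            (hτ a).mono (by simp [D])
        _ ≤ ∑ b ∈ F.filter (a < ·), τ a (A b) := (hτ a).biUnion_le _ _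
        _ ≤ ∑ b ∈ F.filter (a < ·), w b :=
            Finset.sum_le_sum fun b hb => hA a b (Finset.mem_filter.1 hb).2
        _ ≤ η := hw _
  obtain ⟨i, hi⟩ := ((Filter.eventually_all_finset F).2 hlarge).exists
  have h3 := (hτ i).sum_le_of_pairwise_disjoint F D (by
    have key : ∀ a ∈ F, ∀ b ∈ F, a < b → Disjoint (D a) (D b) := fun a _ b hb hab =>
      Disjoint.mono_right Set.sdiff_subset (Set.disjoint_left.2 fun x hx hxb =>
        hx.2 (Set.mem_biUnion (Finset.mem_filter.2 ⟨hb, hab⟩) hxb))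
    intro a ha b hb hab
    rcases lt_or_gt_of_ne hab with h | h
    · exact key a ha b hb h
    · exact (key b hb a ha h).symm)
  have h4 : F.card • δ ≤ ∑ a ∈ F, τ i (D a) := Finset.card_nsmul_le_sum _ _ _ hi
  rw [hFN, nsmul_eq_mul] at h4
  linarith [hC i]

include hw0

/-- A disjointification lemma in the spirit of Rosenthal. -/
theorem exists_disjoint_subsequence {m : Set Γ → ℝ} (hm : IsFinitelyAdditive m) :
    ∃ (a : ℕ → ℕ) (D : ℕ → Set Γ), StrictMono a ∧ (∀ s, D s ⊆ A (a s)) ∧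
      (∀ s, τ (a s) (A (a s) \ D s) ≤ 2 * η) ∧ Pairwise (Function.onFun Disjoint D) ∧
      m (⋃ s, D s) ≤ η := by
  classical
  have hη : 0 < η := (hw0 0).trans_le (by simpa using hw {0})
  -- The triples are (counter, index, set). The increasing counter makes the errors w of different
  -- stages distinct terms of a sum bounded by η.
  obtain ⟨f, hfP, hfr⟩ := exists_seq_of_forall_finset_exists
    (fun p : ℕ × ℕ × Set Γ => p.2.2 ⊆ A p.2.1 ∧ τ p.2.1 (A p.2.1 \ p.2.2) ≤ η ∧
      ∀ᶠ i in (hyperfilter ℕ : Filter ℕ), τ i p.2.2 < w p.1)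
    (fun p q => p.1 < q.1 ∧ p.2.1 < q.2.1 ∧ τ q.2.1 p.2.2 < w p.1) (by
      intro s hs
      have hS : {i | ∀ p ∈ s, τ i p.2.2 < w p.1 ∧ p.2.1 < i} ∈ hyperfilter ℕ := by
        refine (Filter.eventually_all_finset s).2 fun p hp => (hs p hp).2.2.and ?_
        exact (eventually_gt_atTop p.2.1).filter_mono Nat.hyperfilter_le_atTop
      obtain ⟨a, haS, D, hD, hD', hD''⟩ := exists_large_subset_eventually_small hτ hC hw hA hS
        (hw0 (s.sup (fun p => p.1) + 1))
      refine ⟨⟨s.sup (fun p => p.1) + 1, a, D⟩, ⟨hD, hD', hD''⟩, fun p hp => ⟨?_, ?_, ?_⟩⟩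
      · exact Nat.lt_succ_of_le (Finset.le_sup (f := fun p : ℕ × ℕ × Set Γ => p.1) hp)
      · exact (haS p hp).2
      · exact (haS p hp).1)
  let E : ℕ → Set Γ := fun s => (f s).2.2 \ ⋃ r ∈ Finset.range s, (f r).2.2
  have hk : Function.Injective fun s => (f s).1 :=
    (strictMono_nat_of_lt_succ fun n => (hfr n (n + 1) n.lt_succ_self).1).injective
  -- One η was lost when the set was chosen inside A, the other is lost to the sets of earlier
  -- stages.
  have hE1 : ∀ s, τ (f s).2.1 (A (f s).2.1 \ E s) ≤ 2 * η := by
    intro s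
    have hsub : A (f s).2.1 \ E s ⊆
        (A (f s).2.1 \ (f s).2.2) ∪ ⋃ r ∈ Finset.range s, (f r).2.2 := by
      intro x hx
      by_cases h : x ∈ (f s).2.2
      · right
        by_contra h'
        exact hx.2 ⟨h, h'⟩
      · exact Or.inl ⟨hx.1, h⟩
    have h1 := ((hτ (f s).2.1).mono hsub).trans ((hτ _).union_le _ _)
    have h2 : τ (f s).2.1 (⋃ r ∈ Finset.range s, (f r).2.2) ≤ η :=
      calc _ ≤ ∑ r ∈ Finset.range s, τ (f s).2.1 (f r).2.2 := (hτ _).biUnion_le _ _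
        _ ≤ ∑ r ∈ Finset.range s, w (f r).1 :=
          Finset.sum_le_sum fun r hr => (hfr r s (Finset.mem_range.1 hr)).2.2.le
        _ = ∑ i ∈ (Finset.range s).image fun r => (f r).1, w i := by
          rw [Finset.sum_image hk.injOn]
        _ ≤ η := hw _
    linarith [(hfP s).2.1]
  have hE2 : Pairwise (Function.onFun Disjoint E) := by
    have key : ∀ r s, r < s → Disjoint (E r) (E s) := fun r s hrs =>
      Disjoint.mono_left Set.sdiff_subset (Set.disjoint_right.2 fun x hx hxr =>
        hx.2 (Set.mem_biUnion (Finset.mem_range.2 hrs) hxr))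
    intro r s hrs
    rcases lt_or_gt_of_ne hrs with h | h
    · exact key r s h
    · exact (key s r h).symm
  -- As m is only finitely additive, small values m (E s) would not control the union. Instead, the
  -- N residue classes modulo N give disjoint unions, and one of them has mass at most η.
  obtain ⟨N, hN⟩ := exists_nat_gt (m Set.univ / η)
  rw [div_lt_iff₀ hη] at hN
  have hN0 : 0 < N := by
    rcases Nat.eq_zero_or_pos N with rfl | h
    · simp only [Nat.cast_zero, zero_mul] at hN
      exact absurd (hm.nonneg _) (not_le.2 hN)
    · exact h
  obtain ⟨r, -, hr⟩ : ∃ r ∈ Finset.range N, m (⋃ q, E (r + N * q)) ≤ η := by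
    by_contra! hcon
    have h1 := hm.sum_le_of_pairwise_disjoint (Finset.range N) (fun r => ⋃ q, E (r + N * q)) (by
      intro i hi j hj hij
      simp only [Set.disjoint_iUnion_left, Set.disjoint_iUnion_right]
      refine fun q q' => hE2 fun e => hij ?_
      have := congrArg (· % N) e
      simpa [Nat.mod_eq_of_lt (Finset.mem_range.1 hi), Nat.mod_eq_of_lt (Finset.mem_range.1 hj)]
        using this)
    have h2 := Finset.card_nsmul_le_sum (Finset.range N) _ η (fun r hr => (hcon r hr).le)
    rw [Finset.card_range, nsmul_eq_mul] at h2
    linarith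
  have hmono : StrictMono fun q => r + N * q := fun q q' h => by
    simpa [hN0] using h
  refine ⟨fun q => (f (r + N * q)).2.1, fun q => E (r + N * q), ?_, ?_, fun q => hE1 _, ?_, hr⟩
  · exact fun q q' h => (hfr _ _ (hmono h)).2.1
  · exact fun q => Set.sdiff_subset.trans (hfP _).1
  · exact fun q q' h => hE2 (hmono.injective.ne h)

end Masses

/-! ### Weak limits, norming vectors, continuous approximation -/

section WeakLimit

variable {𝕜 H : Type*} [RCLike 𝕜] [NormedAddCommGroup H] [InnerProductSpace 𝕜 H] [CompleteSpace H]

/-- Bounded sequences in a Hilbert space converge weakly along ultrafilters. -/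
theorem exists_weak_limit_of_norm_le {ι : Type*} (U : Ultrafilter ι) {v : ι → H} {B : ℝ}
    (hB : ∀ j, ‖v j‖ ≤ B) :
    ∃ h : H, ∀ T : StrongDual 𝕜 H, Tendsto (fun j => T (v j)) U (𝓝 (T h)) := by
  -- Banach–Alaoglu, with H identified with its dual. The identification is conjugate-linear, hence
  -- the conjugation in `h3`.
  have hc := WeakDual.isCompact_closedBall (0 : StrongDual 𝕜 H) B
  let d : ι → WeakDual 𝕜 H := fun j => StrongDual.toWeakDual (InnerProductSpace.toDual 𝕜 H (v j))
  obtain ⟨ψ, -, hψ⟩ := hc.ultrafilter_le_nhds (U.map d) (by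
    rw [le_principal_iff]
    refine Filter.mem_map.2 (Filter.univ_mem' fun j => ?_)
    simpa [d] using hB j)
  refine ⟨(InnerProductSpace.toDual 𝕜 H).symm (WeakDual.toStrongDual ψ), fun T => ?_⟩
  have hT : ∀ y, T y = inner 𝕜 ((InnerProductSpace.toDual 𝕜 H).symm T) y := fun y => by
    rw [InnerProductSpace.toDual_symm_apply]
  have h1 : Tendsto d U (𝓝 ψ) := hψ
  have h2 := ((WeakDual.eval_continuous ((InnerProductSpace.toDual 𝕜 H).symm T)).tendsto ψ).comp h1
  have h3 := (RCLike.continuous_conj.tendsto _).comp h2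
  simp only [hT]
  convert! h3 using 2
  · simp [d, Function.comp_def]
  · rw [← inner_conj_symm, InnerProductSpace.toDual_symm_apply]
    rfl

end WeakLimit

section NormingVector

variable {𝕜 X : Type*} [RCLike 𝕜] [NormedAddCommGroup X] [NormedSpace 𝕜 X]

theorem exists_unit_ball_lt_re_apply (ν : StrongDual 𝕜 X) {r : ℝ} (hr : r < ‖ν‖) :
    ∃ x : X, ‖x‖ ≤ 1 ∧ r < RCLike.re (ν x) := by
  obtain ⟨x, hx, hrx⟩ : ∃ x : X, ‖x‖ ≤ 1 ∧ r < ‖ν x‖ := by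
    obtain ⟨x, hx, hrx⟩ := ν.exists_lt_apply_of_lt_opNorm hr
    exact ⟨x, hx.le, hrx⟩
  obtain ⟨a, ha, ha'⟩ := RCLike.exists_norm_eq_mul_self (ν x)
  refine ⟨a • x, by rw [norm_smul, ha, one_mul]; exact hx, ?_⟩
  rw [map_smul, smul_eq_mul, ← ha', RCLike.ofReal_re]
  exact hrx

end NormingVector

section Approximation

theorem integrable_mul_of_memLp_two {α 𝕜 : Type*} [RCLike 𝕜] {m : MeasurableSpace α} {μ : Measure α}
    {u h : α → 𝕜} (hu : MemLp u 2 μ) (hh : MemLp h 2 μ) :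
    Integrable (fun x => u x * h x) μ :=
  hu.integrable_mul hh

variable {𝕜 : Type*} [RCLike 𝕜] {K : Type*} [TopologicalSpace K] [CompactSpace K] [T2Space K]
  [MeasurableSpace K] [BorelSpace K] {μ : Measure K} [μ.Regular]

/-- Radial projection onto the unit disc moves f by at most |u - f|, as |u| ≤ 1. The error at most
doubles, whence δ / 2. -/
theorem exists_continuous_unit_ball_eLpNorm_sub_le {u : K → 𝕜} (hu : MemLp u 2 μ)
    (hu1 : ∀ x, ‖u x‖ ≤ 1) {δ : ℝ} (hδ : 0 < δ) :
    ∃ s : C(K, 𝕜), ‖s‖ ≤ 1 ∧ (eLpNorm (fun x => s x - u x) 2 μ).toReal ≤ δ := by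
  obtain ⟨f, hf, -⟩ := hu.exists_boundedContinuous_eLpNorm_sub_le (by simp)
    (ε := ENNReal.ofReal (δ / 2)) (by simpa using hδ)
  have hpos : ∀ x, 0 < max 1 ‖f x‖ := fun x => lt_max_of_lt_left one_pos
  have hcont : Continuous fun x => (max 1 ‖f x‖)⁻¹ :=
    Continuous.inv₀ (by fun_prop) fun x => (hpos x).ne'
  let s : C(K, 𝕜) := ⟨fun x => (((max 1 ‖f x‖)⁻¹ : ℝ) : 𝕜) * f x,
    (RCLike.continuous_ofReal.comp hcont).mul f.continuous⟩
  have hs : ∀ x, s x = (((max 1 ‖f x‖)⁻¹ : ℝ) : 𝕜) * f x := fun x => rfl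
  refine ⟨s, (ContinuousMap.norm_le _ zero_le_one).2 fun x => ?_, ?_⟩
  · rw [hs, norm_mul, RCLike.norm_ofReal, abs_of_pos (inv_pos.2 (hpos x)), inv_mul_le_iff₀ (hpos x)]
    simp
  · have h1 : ∀ x, ‖s x - f x‖ ≤ ‖u x - f x‖ := by
      intro x
      have e : s x - f x = (((max 1 ‖f x‖)⁻¹ - 1 : ℝ) : 𝕜) * f x := by
        rw [hs]; push_cast; ring
      rw [e, norm_mul, RCLike.norm_ofReal]
      rcases le_total ‖f x‖ 1 with h | h
      · simp [max_eq_left h]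
      · rw [max_eq_right h, abs_of_nonpos (by
          rw [sub_nonpos]; exact inv_le_one_of_one_le₀ h)]
        have : -(‖f x‖⁻¹ - 1) * ‖f x‖ = ‖f x‖ - 1 := by
          have : ‖f x‖ ≠ 0 := by positivity
          field_simp
          ring
        rw [this]
        have h2 := norm_sub_norm_le (f x) (u x)
        rw [norm_sub_rev] at h2
        linarith [hu1 x]
    have h2 : eLpNorm (fun x => s x - u x) 2 μ ≤ ENNReal.ofReal 2 * eLpNorm (u - ⇑f) 2 μ := by
      refine eLpNorm_le_mul_eLpNorm_of_ae_le_mul (Eventually.of_forall fun x => ?_) 2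
      calc ‖s x - u x‖ = ‖(s x - f x) - (u x - f x)‖ := by congr 1; ring
        _ ≤ ‖s x - f x‖ + ‖u x - f x‖ := norm_sub_le _ _
        _ ≤ 2 * ‖(u - ⇑f) x‖ := by
          simp only [Pi.sub_apply]
          linarith [h1 x]
    refine ENNReal.toReal_le_of_le_ofReal hδ.le (h2.trans ?_)
    calc _ ≤ ENNReal.ofReal 2 * ENNReal.ofReal (δ / 2) := by gcongr
      _ = ENNReal.ofReal δ := by rw [← ENNReal.ofReal_mul zero_le_two]; congr 1; ring

variable [IsFiniteMeasure μ]

theorem exists_continuous_unit_ball_integral_near {u : K → 𝕜} (hu : MemLp u 2 μ)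
    (hu1 : ∀ x, ‖u x‖ ≤ 1) {h : K → 𝕜} (hh : MemLp h 2 μ) {ε : ℝ} (hε : 0 < ε) :
    ∃ s : C(K, 𝕜), ‖s‖ ≤ 1 ∧ ‖∫ x, s x * h x ∂μ - ∫ x, u x * h x ∂μ‖ ≤ ε ∧
      ∫ x, ‖s x - u x‖ ∂μ ≤ ε := by
  set B := (eLpNorm h 2 μ).toReal + (eLpNorm (fun _ => (1 : 𝕜)) 2 μ).toReal + 1 with hB
  have hB0 : 0 < B := by positivity
  obtain ⟨s, hs1, hs⟩ := exists_continuous_unit_ball_eLpNorm_sub_le hu hu1 (div_pos hε hB0)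
  have hsu : MemLp (fun x => s x - u x) 2 μ := (s.memLp_two μ).sub hu
  have hle : ∀ r : ℝ, 0 ≤ r → r ≤ B →
      (eLpNorm (fun x => s x - u x) 2 μ).toReal * r ≤ ε := fun r h0 hr => by
    calc _ ≤ ε / B * B := by gcongr
      _ = ε := div_mul_cancel₀ _ hB0.ne'
  refine ⟨s, hs1, ?_, ?_⟩
  · rw [← integral_sub (integrable_mul_of_memLp_two (s.memLp_two μ) hh)
      (integrable_mul_of_memLp_two hu hh)]
    refine (norm_integral_le_integral_norm _).trans ?_
    simp only [← sub_mul, norm_mul]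
    refine (integral_norm_mul_norm_le_eLpNorm_two hsu hh).trans (hle _ (by positivity) ?_)
    rw [hB]; linarith [ENNReal.toReal_nonneg (a := eLpNorm (fun _ => (1 : 𝕜)) 2 μ)]
  · have h1 := integral_norm_mul_norm_le_eLpNorm_two hsu (memLp_const (1 : 𝕜))
    simp only [norm_one, mul_one] at h1
    refine h1.trans (hle _ (by positivity) ?_)
    rw [hB]; linarith [ENNReal.toReal_nonneg (a := eLpNorm h 2 μ)]

end Approximation

/-! ### Tails of L² densities -/

section Truncation

variable {𝕜 : Type*} [RCLike 𝕜] {α : Type*} {mα : MeasurableSpace α} {μ : Measure α}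

theorem measurableSet_lt_norm_lp (g : Lp 𝕜 2 μ) (M : ℝ) : MeasurableSet {x | M < ‖g x‖} :=
  measurableSet_lt measurable_const (Lp.stronglyMeasurable g).norm.measurable

/-- The part of `g ∈ L²(μ)` where its absolute value exceeds `M`. -/
noncomputable def lpTail (g : Lp 𝕜 2 μ) (M : ℝ) : Lp 𝕜 2 μ :=
  ((Lp.memLp g).indicator (measurableSet_lt_norm_lp g M)).toLp _

theorem coeFn_lpTail (g : Lp 𝕜 2 μ) (M : ℝ) :
    lpTail g M =ᵐ[μ] {x | M < ‖g x‖}.indicator g :=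
  MemLp.coeFn_toLp _

theorem norm_sub_lpTail_apply_le (g : Lp 𝕜 2 μ) {M : ℝ} (hM : 0 ≤ M) :
    ∀ᵐ x ∂μ, ‖(g - lpTail g M) x‖ ≤ M := by
  filter_upwards [Lp.coeFn_sub g (lpTail g M), coeFn_lpTail g M] with x h1 h2
  rw [h1, Pi.sub_apply, h2, Set.indicator_apply]
  split_ifs with h
  · simpa using hM
  · simpa using h

/-- A bounded function `u` with `u g = |g|`. -/
noncomputable def conjSign (g : α → 𝕜) (x : α) : 𝕜 :=
  ((‖g x‖⁻¹ : ℝ) : 𝕜) * starRingEnd 𝕜 (g x)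

theorem norm_conjSign_le (g : α → 𝕜) (x : α) : ‖conjSign g x‖ ≤ 1 := by
  rw [conjSign, norm_mul, RCLike.norm_ofReal, RCLike.norm_conj, abs_of_nonneg (by positivity)]
  exact inv_mul_le_one

theorem conjSign_mul_self (g : α → 𝕜) (x : α) : conjSign g x * g x = (‖g x‖ : 𝕜) := by
  rw [conjSign, mul_assoc, RCLike.conj_mul]
  rcases eq_or_ne (g x) 0 with h | h
  · simp [h]
  · have : (‖g x‖ : 𝕜) ≠ 0 := by simpa using h
    push_cast
    field_simp

theorem stronglyMeasurable_conjSign {g : α → 𝕜} (hg : StronglyMeasurable g) :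
    StronglyMeasurable (conjSign g) :=
  (RCLike.continuous_ofReal.comp_stronglyMeasurable hg.norm.measurable.inv.stronglyMeasurable).mul
    (RCLike.continuous_conj.comp_stronglyMeasurable hg)

variable [IsFiniteMeasure μ]

theorem lp_two_integrable (g : Lp 𝕜 2 μ) : Integrable g μ :=
  (Lp.memLp g).integrable (by norm_num)

theorem memLp_indicator_conjSign (g : Lp 𝕜 2 μ) {E : Set α} (hE : MeasurableSet E) :
    MemLp (E.indicator (conjSign g)) 2 μ :=
  MemLp.of_bound ((stronglyMeasurable_conjSign
    (Lp.stronglyMeasurable g)).indicator hE).aestronglyMeasurable 1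
    (Eventually.of_forall fun _ =>
      (norm_indicator_le_norm_self _ _).trans (norm_conjSign_le _ _))

theorem integral_norm_lpTail_le (g : Lp 𝕜 2 μ) (M : ℝ) :
    ∫ x, ‖lpTail g M x‖ ∂μ ≤ ∫ x, ‖g x‖ ∂μ := by
  refine integral_mono_ae (lp_two_integrable _).norm (lp_two_integrable g).norm ?_
  filter_upwards [coeFn_lpTail g M] with x hx
  rw [hx]
  exact norm_indicator_le_norm_self _ _

theorem measureReal_lt_norm_le (g : Lp 𝕜 2 μ) {C L : ℝ} (hL : 0 < L)
    (hC : ∫ x, ‖g x‖ ∂μ ≤ C) : μ.real {x | L < ‖g x‖} ≤ C / L := by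
  rw [le_div_iff₀ hL, mul_comm]
  refine le_trans ?_ hC
  refine le_trans ?_ (mul_meas_ge_le_integral_of_nonneg
    (Eventually.of_forall fun x => norm_nonneg (g x)) (lp_two_integrable g).norm L)
  exact mul_le_mul_of_nonneg_left (measureReal_mono (fun x (hx : L < ‖g x‖) => hx.le)
    (measure_ne_top _ _)) hL.le

/-- The almost optimal threshold and value for the mass of the tails along an ultrafilter. -/
theorem exists_threshold {ι : Type*} (U : Ultrafilter ι) {T : ι → ℕ → ℝ} (hT0 : ∀ j M, 0 ≤ T j M)
    {C : ℝ} (hC : ∀ j M, T j M ≤ C) {ε : ℝ} (hε : 0 < ε) :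
    ∃ (M : ℕ) (b : ℝ), (∀ᶠ j in U, T j M ≤ b + ε) ∧ ∀ L : ℕ, ∀ᶠ j in U, b - ε ≤ T j L := by
  -- The infimum of S serves as b. For an ultrafilter, failure of the eventual upper bound b - ε is
  -- an eventual lower bound.
  let S : Set ℝ := {r | ∃ M : ℕ, ∀ᶠ j in U, T j M ≤ r}
  have hne : S.Nonempty := ⟨C, 0, Eventually.of_forall fun j => hC j 0⟩
  have hbdd : BddBelow S := ⟨0, by
    rintro r ⟨M, hM⟩
    obtain ⟨j, hj⟩ := hM.exists
    exact (hT0 j M).trans hj⟩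
  obtain ⟨r, ⟨M, hM⟩, hr⟩ := exists_lt_of_csInf_lt hne (lt_add_of_pos_right (sInf S) hε)
  refine ⟨M, sInf S, hM.mono fun j hj => hj.trans hr.le, fun L => ?_⟩
  have h : ¬∀ᶠ j in U, T j L ≤ sInf S - ε := fun h => by
    linarith [csInf_le hbdd (show sInf S - ε ∈ S from ⟨L, h⟩)]
  exact (Ultrafilter.eventually_not.2 h).mono fun j hj => (not_le.1 hj).le

end Truncation

/-! ### Norming the bounded parts and the tails -/

section Concentration

variable {𝕜 : Type*} [RCLike 𝕜] {K : Type*} [TopologicalSpace K] [CompactSpace K]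
  [MeasurableSpace K] [BorelSpace K] {μ : Measure K} [IsFiniteMeasure μ]

theorem norm_lpDensity_le (g : Lp 𝕜 2 μ) : ‖lpDensity μ g‖ ≤ ∫ x, ‖g x‖ ∂μ := by
  refine ContinuousLinearMap.opNorm_le_bound _ (integral_nonneg fun x => norm_nonneg _) fun f => ?_
  rw [lpDensity_apply]
  refine (norm_integral_le_integral_norm _).trans ?_
  rw [mul_comm, ← integral_const_mul]
  refine integral_mono_of_nonneg (Eventually.of_forall fun x => norm_nonneg _)
    ((lp_two_integrable g).norm.const_mul _) (Eventually.of_forall fun x => ?_)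
  simp only [norm_mul]
  gcongr
  exact f.norm_coe_le_norm x

/-- The truncated part of a sequence of densities is norming, up to the mass of the tails. -/
theorem exists_norming_truncation {g : ℕ → Lp 𝕜 2 μ} (U : Ultrafilter ℕ)
    {φ : StrongDual 𝕜 (StrongDual 𝕜 C(K, 𝕜))} (hφ : ‖φ‖ ≤ 1) {c : ℝ}
    (hc : ∀ᶠ j in U, c ≤ RCLike.re (φ (lpDensity μ (g j)))) {M : ℝ} (hM : 0 ≤ M) {b : ℝ}
    (hb : ∀ᶠ j in U, ∫ x, ‖lpTail (g j) M x‖ ∂μ ≤ b) {ε : ℝ} (hε : 0 < ε) :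
    ∃ f : C(K, 𝕜), ‖f‖ ≤ 1 ∧
      ∀ᶠ j in U, c - b - ε ≤ RCLike.re (lpDensity μ (g j - lpTail (g j) M) f) := by
  obtain ⟨h, hh⟩ := exists_weak_limit_of_norm_le (𝕜 := 𝕜) U
    (v := fun j => g j - lpTail (g j) M) fun j => Lp.norm_le_of_ae_bound hM
      (norm_sub_lpTail_apply_le (g j) hM)
  -- `φ.comp (lpDensity μ)` is a functional on L²(μ), so it passes to the weak limit; discarding the
  -- tails costs at most b.
  have h1 : c - b ≤ RCLike.re (φ (lpDensity μ h)) := by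
    refine ge_of_tendsto (x := (U : Filter ℕ))
      ((RCLike.continuous_re.tendsto _).comp (hh (φ.comp (lpDensity μ)))) ?_
    filter_upwards [hc, hb] with j h1 h2
    have h3 : ‖φ (lpDensity μ (lpTail (g j) M))‖ ≤ ∫ x, ‖lpTail (g j) M x‖ ∂μ := by
      simpa using φ.le_of_opNorm_le_of_le hφ (norm_lpDensity_le (lpTail (g j) M))
    have h4 := (RCLike.re_le_norm _).trans h3
    simp only [Function.comp_apply, ContinuousLinearMap.comp_apply, map_sub]
    linarith
  have h2 : ‖φ (lpDensity μ h)‖ ≤ ‖lpDensity μ h‖ := by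
    simpa using φ.le_of_opNorm_le hφ (lpDensity μ h)
  have h3 := RCLike.re_le_norm (φ (lpDensity μ h))
  obtain ⟨f, hf1, hf⟩ := exists_unit_ball_lt_re_apply (lpDensity μ h) (r := c - b - ε) (by linarith)
  refine ⟨f, hf1, ?_⟩
  have h4 := (RCLike.continuous_re.tendsto _).comp
    (hh ((ContinuousLinearMap.apply 𝕜 𝕜 f).comp (lpDensity μ)))
  exact (h4.eventually (eventually_gt_nhds hf)).mono fun j hj => le_of_lt hj

variable [T2Space K] [μ.Regular]

theorem integral_norm_le_norm_lpDensity (g : Lp 𝕜 2 μ) : ∫ x, ‖g x‖ ∂μ ≤ ‖lpDensity μ g‖ := by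
  refine le_of_forall_pos_le_add fun ε hε => ?_
  obtain ⟨s, hs1, hs, -⟩ := exists_continuous_unit_ball_integral_near
    (by simpa using memLp_indicator_conjSign g MeasurableSet.univ) (norm_conjSign_le g)
    (Lp.memLp g) hε
  simp only [conjSign_mul_self, integral_ofReal] at hs
  rw [← lpDensity_apply] at hs
  have h1 : ‖lpDensity μ g s‖ ≤ ‖lpDensity μ g‖ := by
    simpa using (lpDensity μ g).le_of_opNorm_le_of_le le_rfl hs1
  have h2 := norm_sub_norm_le ((∫ x, ‖g x‖ ∂μ : ℝ) : 𝕜) (lpDensity μ g s)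
  rw [norm_sub_rev, RCLike.norm_ofReal,
    abs_of_nonneg (integral_nonneg fun x => norm_nonneg _)] at h2
  linarith

/-- The mass of `g` above a high level `L` is almost attained by a continuous function in the
unit ball with small integral. -/
theorem exists_continuous_concentrated (g : Lp 𝕜 2 μ) {M L : ℝ} (hML : M ≤ L) {ε : ℝ}
    (hε : 0 < ε) :
    ∃ s : C(K, 𝕜), ‖s‖ ≤ 1 ∧
      ∫ x, ‖lpTail g L x‖ ∂μ - ε ≤ RCLike.re (lpDensity μ (lpTail g M) s) ∧
      ∫ x, ‖s x‖ ∂μ ≤ μ.real {x | L < ‖g x‖} + ε := by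
  set E := {x | L < ‖g x‖} with hE
  have hEm : MeasurableSet E := measurableSet_lt_norm_lp g L
  have hu1 : ∀ x, ‖E.indicator (conjSign g) x‖ ≤ E.indicator (fun _ => (1 : ℝ)) x := fun x => by
    by_cases h : x ∈ E
    · simpa [h] using norm_conjSign_le g x
    · simp [h]
  obtain ⟨s, hs1, hs, hs'⟩ := exists_continuous_unit_ball_integral_near
    (memLp_indicator_conjSign g hEm)
    (fun x => (norm_indicator_le_norm_self _ _).trans (norm_conjSign_le g x))
    (Lp.memLp (lpTail g M)) hε
  refine ⟨s, hs1, ?_, ?_⟩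
  · have h1 : ∫ x, E.indicator (conjSign g) x * lpTail g M x ∂μ
        = ((∫ x, ‖lpTail g L x‖ ∂μ : ℝ) : 𝕜) := by
      rw [← integral_ofReal]
      refine integral_congr_ae ?_
      filter_upwards [coeFn_lpTail g M, coeFn_lpTail g L] with x h2 h3
      rw [h2, h3]
      by_cases h : x ∈ E
      · have h' : x ∈ {x | M < ‖g x‖} := lt_of_le_of_lt hML h
        rw [Set.indicator_of_mem h, Set.indicator_of_mem h', Set.indicator_of_mem h,
          conjSign_mul_self]
      · rw [Set.indicator_of_notMem h, Set.indicator_of_notMem h]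
        simp
    rw [h1, ← lpDensity_apply] at hs
    have h2 := (RCLike.abs_re_le_norm _).trans hs
    rw [map_sub, RCLike.ofReal_re, abs_le] at h2
    linarith [h2.1]
  · have hi1 : Integrable (fun x => ‖s x - E.indicator (conjSign g) x‖) μ :=
      (((s.memLp_two μ).sub (memLp_indicator_conjSign g hEm)).integrable (by norm_num)).norm
    have hi2 : Integrable (E.indicator fun _ => (1 : ℝ)) μ :=
      (integrable_const 1).indicator hEm
    have h1 : ∫ x, ‖s x‖ ∂μ ≤
        ∫ x, ‖s x - E.indicator (conjSign g) x‖ + E.indicator (fun _ => (1 : ℝ)) x ∂μ := by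
      refine integral_mono_of_nonneg (Eventually.of_forall fun x => norm_nonneg _)
        (hi1.add hi2) (Eventually.of_forall fun x => ?_)
      have := norm_add_le (s x - E.indicator (conjSign g) x) (E.indicator (conjSign g) x)
      rw [sub_add_cancel] at this
      linarith [hu1 x]
    rw [integral_add hi1 hi2, integral_indicator_const _ hEm, smul_eq_mul, mul_one] at h1
    linarith

end Concentration

/-! ### Clopen sets and gluing in βΓ -/

section Hat

variable {Γ : Type*}

/-- The closure of `A ⊆ Γ` in the Stone–Čech compactification of the discrete space `Γ`. -/
def ultrafilterHat (A : Set Γ) : Set (Ultrafilter Γ) := {u | A ∈ u}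

theorem isClopen_ultrafilterHat (A : Set Γ) : IsClopen (ultrafilterHat A) :=
  ⟨ultrafilter_isClosed_basic A, ultrafilter_isOpen_basic A⟩

theorem ultrafilterHat_univ : ultrafilterHat (Set.univ : Set Γ) = Set.univ :=
  Set.eq_univ_of_forall fun u => (Filter.univ_mem : Set.univ ∈ (u : Filter Γ))

theorem ultrafilterHat_compl (A : Set Γ) : ultrafilterHat Aᶜ = (ultrafilterHat A)ᶜ :=
  Set.ext fun _ => Ultrafilter.compl_mem_iff_notMem

theorem ultrafilterHat_union (A B : Set Γ) :
    ultrafilterHat (A ∪ B) = ultrafilterHat A ∪ ultrafilterHat B :=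
  Set.ext fun _ => Ultrafilter.union_mem_iff

theorem disjoint_ultrafilterHat {A B : Set Γ} (h : Disjoint A B) :
    Disjoint (ultrafilterHat A) (ultrafilterHat B) :=
  Set.disjoint_left.2 fun u hA hB => by
    have := Filter.inter_mem hA hB
    rw [Set.disjoint_iff_inter_eq_empty.1 h] at this
    exact u.empty_notMem this

theorem ultrafilterHat_subset_of_isClosed {A : Set Γ} {F : Set (Ultrafilter Γ)} (hF : IsClosed F)
    (h : ∀ γ ∈ A, (pure γ : Ultrafilter Γ) ∈ F) : ultrafilterHat A ⊆ F := by
  intro u hu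
  by_contra huF
  obtain ⟨γ, hγ⟩ := denseRange_pure.exists_mem_open
    ((isClopen_ultrafilterHat A).isOpen.inter hF.isOpen_compl) ⟨u, hu, huF⟩
  exact hγ.2 (h γ hγ.1)

variable {𝕜 : Type*} [RCLike 𝕜]

/-- Bounded functions on `Γ` extend to `Ultrafilter Γ`. -/
theorem exists_continuousMap_extension (f : Γ → 𝕜) {B : ℝ} (hf : ∀ γ, ‖f γ‖ ≤ B) (hB : 0 ≤ B) :
    ∃ x : C(Ultrafilter Γ, 𝕜), (∀ γ, x (pure γ) = f γ) ∧ ‖x‖ ≤ B := by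
  let f' : Γ → Metric.closedBall (0 : 𝕜) B := fun γ => ⟨f γ, by simpa using hf γ⟩
  have : CompactSpace (Metric.closedBall (0 : 𝕜) B) :=
    isCompact_iff_compactSpace.1 (isCompact_closedBall 0 B)
  refine ⟨⟨Subtype.val ∘ Ultrafilter.extend f',
    continuous_subtype_val.comp (continuous_ultrafilter_extend f')⟩, fun γ => ?_, ?_⟩
  · exact congrArg Subtype.val (congrFun (ultrafilter_extend_extends f') γ)
  · refine (ContinuousMap.norm_le _ hB).2 fun u => ?_
    exact mem_closedBall_zero_iff.1 (Ultrafilter.extend f' u).2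

/-- Continuous functions on `Ultrafilter Γ` can be glued along disjoint subsets of `Γ`. -/
theorem exists_continuousMap_glue {D : ℕ → Set Γ} (hD : Pairwise (Function.onFun Disjoint D))
    {s : ℕ → C(Ultrafilter Γ, 𝕜)} (hs : ∀ n, ‖s n‖ ≤ 1) {f : C(Ultrafilter Γ, 𝕜)}
    (hf : ‖f‖ ≤ 1) :
    ∃ x : C(Ultrafilter Γ, 𝕜), ‖x‖ ≤ 1 ∧ (∀ n, ∀ u ∈ ultrafilterHat (D n), x u = s n u) ∧
      ∀ u, u ∉ ultrafilterHat (⋃ n, D n) → x u = f u := by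
  classical
  -- Gluing on Γ needs no continuity; the agreements then pass to closures. At points in the closure
  -- of the union but in no single closure, only the norm bound survives.
  obtain ⟨x, hx, hx1⟩ := exists_continuousMap_extension
    (fun γ => if h : ∃ n, γ ∈ D n then s h.choose (pure γ) else f (pure γ)) (B := 1)
    (fun γ => by
      split_ifs with h
      · exact ((s _).norm_coe_le_norm _).trans (hs _)
      · exact (f.norm_coe_le_norm _).trans hf) zero_le_one
  refine ⟨x, hx1, fun n => ?_, fun u hu => ?_⟩
  · refine ultrafilterHat_subset_of_isClosed (F := {u | x u = s n u})
      (isClosed_eq x.continuous (s n).continuous) fun γ hγ => ?_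
    have h : ∃ n, γ ∈ D n := ⟨n, hγ⟩
    have h' : h.choose = n := by
      by_contra hne
      exact Set.disjoint_left.1 (hD hne) h.choose_spec hγ
    simp only [Set.mem_ofPred_eq, hx, dif_pos h, h']
  · refine ultrafilterHat_subset_of_isClosed (A := (⋃ n, D n)ᶜ) (F := {u | x u = f u})
      (isClosed_eq x.continuous f.continuous) (fun γ hγ => ?_)
      ((ultrafilterHat_compl _).symm ▸ hu)
    have h : ¬∃ n, γ ∈ D n := by simpa using hγ
    simp only [Set.mem_ofPred_eq, hx, dif_neg h]

/-- The subset of `Γ` where a continuous function is large. -/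
def largeSet (s : C(Ultrafilter Γ, 𝕜)) : Set Γ := {γ | 1 / 2 < ‖s (pure γ)‖}

theorem le_norm_of_mem_hat_largeSet (s : C(Ultrafilter Γ, 𝕜)) {u : Ultrafilter Γ}
    (hu : u ∈ ultrafilterHat (largeSet s)) : 1 / 2 ≤ ‖s u‖ :=
  ultrafilterHat_subset_of_isClosed (A := largeSet s) (F := {u | 1 / 2 ≤ ‖s u‖})
    (isClosed_le continuous_const (by fun_prop)) (fun γ (hγ : 1 / 2 < ‖s (pure γ)‖) => hγ.le) hu

theorem norm_le_of_mem_hat_compl_largeSet (s : C(Ultrafilter Γ, 𝕜)) {u : Ultrafilter Γ}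
    (hu : u ∈ ultrafilterHat (largeSet s)ᶜ) : ‖s u‖ ≤ 1 / 2 :=
  ultrafilterHat_subset_of_isClosed (A := (largeSet s)ᶜ) (F := {u | ‖s u‖ ≤ 1 / 2})
    (isClosed_le (by fun_prop) continuous_const) 
    (fun γ (hγ : ¬1 / 2 < ‖s (pure γ)‖) => not_lt.1 hγ) hu

variable [MeasurableSpace (Ultrafilter Γ)] [BorelSpace (Ultrafilter Γ)]
  {μ : Measure (Ultrafilter Γ)}

theorem measurableSet_ultrafilterHat (A : Set Γ) : MeasurableSet (ultrafilterHat A) :=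
  (isClopen_ultrafilterHat A).isOpen.measurableSet

theorem isFinitelyAdditive_setIntegral {h : Ultrafilter Γ → ℝ} (hh : Integrable h μ)
    (h0 : ∀ u, 0 ≤ h u) : IsFinitelyAdditive fun A => ∫ u in ultrafilterHat A, h u ∂μ where
  nonneg A := integral_nonneg h0
  union A B hAB := by
    rw [ultrafilterHat_union, setIntegral_union (disjoint_ultrafilterHat hAB)
      (measurableSet_ultrafilterHat B) hh.integrableOn hh.integrableOn]

theorem isFinitelyAdditive_measureReal [IsFiniteMeasure μ] :
    IsFinitelyAdditive fun A => μ.real (ultrafilterHat A) where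
  nonneg A := measureReal_nonneg
  union A B hAB := by
    rw [ultrafilterHat_union, measureReal_union (disjoint_ultrafilterHat hAB)
      (measurableSet_ultrafilterHat B)]

variable [IsFiniteMeasure μ]

theorem measureReal_hat_largeSet_le (s : C(Ultrafilter Γ, 𝕜)) :
    μ.real (ultrafilterHat (largeSet s)) ≤ 2 * ∫ u, ‖s u‖ ∂μ := by
  have h1 := mul_meas_ge_le_integral_of_nonneg (μ := μ)
    (Eventually.of_forall fun u => norm_nonneg (s u))
    ((s.memLp_two μ).integrable (by norm_num)).norm (1 / 2)
  have h2 : μ.real (ultrafilterHat (largeSet s)) ≤ μ.real {u | 1 / 2 ≤ ‖s u‖} :=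
    measureReal_mono (fun u hu => le_norm_of_mem_hat_largeSet s hu) (measure_ne_top _ _)
  linarith

/-- Where |s| ≤ 1/2, half the mass of t is wasted. Hence a function s that almost norms t forces t
to have little mass off `largeSet s`. -/
theorem re_lpDensity_apply_le (t : Lp 𝕜 2 μ) {s : C(Ultrafilter Γ, 𝕜)} (hs : ‖s‖ ≤ 1) :
    RCLike.re (lpDensity μ t s) ≤
      ∫ u, ‖t u‖ ∂μ - (∫ u in ultrafilterHat (largeSet s)ᶜ, ‖t u‖ ∂μ) / 2 := by
  have hm := measurableSet_ultrafilterHat (largeSet s)ᶜ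
  have hi := (lp_two_integrable t).norm
  refine (RCLike.re_le_norm _).trans ?_
  rw [lpDensity_apply]
  refine (norm_integral_le_integral_norm _).trans ?_
  rw [← integral_indicator hm, ← integral_div, ← integral_sub hi ((hi.indicator hm).div_const _)]
  refine integral_mono_of_nonneg (Eventually.of_forall fun u => norm_nonneg _)
    (hi.sub ((hi.indicator hm).div_const _)) (Eventually.of_forall fun u => ?_)
  simp only [norm_mul]
  by_cases h : u ∈ ultrafilterHat (largeSet s)ᶜ
  · rw [Set.indicator_of_mem h]
    nlinarith [norm_le_of_mem_hat_compl_largeSet s h, norm_nonneg (t u)]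
  · rw [Set.indicator_of_notMem h]
    nlinarith [(s.norm_coe_le_norm u).trans hs, norm_nonneg (t u)]

theorem norm_lpDensity_sub_le (t : Lp 𝕜 2 μ) {x y : C(Ultrafilter Γ, 𝕜)} (hx : ‖x‖ ≤ 1)
    (hy : ‖y‖ ≤ 1) {E : Set (Ultrafilter Γ)} (hE : MeasurableSet E)
    (hxy : ∀ u, u ∉ E → x u = y u) :
    ‖lpDensity μ t x - lpDensity μ t y‖ ≤ 2 * ∫ u in E, ‖t u‖ ∂μ := by
  have hi := (lp_two_integrable t).norm
  rw [← map_sub, lpDensity_apply, ← integral_indicator hE, ← integral_const_mul]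
  refine (norm_integral_le_integral_norm _).trans (integral_mono_of_nonneg
    (Eventually.of_forall fun u => norm_nonneg _) ((hi.indicator hE).const_mul _)
    (Eventually.of_forall fun u => ?_))
  simp only [norm_mul, ContinuousMap.sub_apply]
  by_cases h : u ∈ E
  · rw [Set.indicator_of_mem h]
    gcongr
    linarith [norm_sub_le (x u) (y u), (x.norm_coe_le_norm u).trans hx,
      (y.norm_coe_le_norm u).trans hy]
  · rw [Set.indicator_of_notMem h, hxy u h]
    simp

end Hat

theorem exists_pos_setIntegral_le {α : Type*} {m : MeasurableSpace α} {μ : MeasureTheory.Measure α}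
    [IsFiniteMeasure μ] {h : α → ℝ} (hh : Integrable h μ) {δ : ℝ} (hδ : 0 < δ) :
    ∃ ρ > 0, ∀ E : Set α, μ.real E ≤ ρ → ∫ x in E, h x ∂μ ≤ δ := by
  have h1 : Tendsto (μ ∘ id) (comap μ.real (𝓝 0)) (𝓝 0) := by
    refine (ENNReal.tendsto_toReal_iff (fun E => measure_ne_top μ E) (by simp)).1 ?_
    exact tendsto_comap
  have h2 := (hh.tendsto_setIntegral_nhds_zero h1).eventually (eventually_le_nhds hδ)
  rw [eventually_comap, Metric.eventually_nhds_iff] at h2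
  obtain ⟨r, hr, H⟩ := h2
  refine ⟨r / 2, half_pos hr, fun E hE => H ?_ E rfl⟩
  rw [Real.dist_eq, sub_zero, abs_of_nonneg measureReal_nonneg]
  linarith

/-! ### Extracting concentrated tails -/

section Extraction

variable {𝕜 : Type*} [RCLike 𝕜] {Γ : Type*} [MeasurableSpace (Ultrafilter Γ)]
  [BorelSpace (Ultrafilter Γ)] {μ : Measure (Ultrafilter Γ)} [IsFiniteMeasure μ] [μ.Regular]

/-- By Chebyshev, {|g_j| > L} has small μ-measure for large L, yet it carries mass at least b - ε.
Absolute continuity of the finitely many earlier tails dictates how small the next set must be. -/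
theorem exists_concentrated_sequence {g : ℕ → Lp 𝕜 2 μ} {C : ℝ}
    (hC : ∀ n, ∫ u, ‖g n u‖ ∂μ ≤ C) {Q : ℕ → Prop}
    (hQ : ∀ᶠ j in (hyperfilter ℕ : Filter ℕ), Q j) (M : ℕ) {b ε : ℝ} (hε : 0 < ε)
    (hb : ∀ L : ℕ, ∀ᶠ j in (hyperfilter ℕ : Filter ℕ), b - ε ≤ ∫ u, ‖lpTail (g j) L u‖ ∂μ)
    {w : ℕ → ℝ} (hw : ∀ n, 0 < w n) :
    ∃ (k j : ℕ → ℕ) (s : ℕ → C(Ultrafilter Γ, 𝕜)), StrictMono k ∧ StrictMono j ∧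
      (∀ n, Q (j n)) ∧ (∀ n, ‖s n‖ ≤ 1) ∧
      (∀ n, b - 2 * ε ≤ RCLike.re (lpDensity μ (lpTail (g (j n)) M) (s n))) ∧
      ∀ m n, m < n →
        ∫ u in ultrafilterHat (largeSet (s n)), ‖lpTail (g (j m)) M u‖ ∂μ ≤ w (k n) := by
  classical
  obtain ⟨F, hP, hr⟩ := exists_seq_of_forall_finset_exists
    (fun p : ℕ × ℕ × C(Ultrafilter Γ, 𝕜) => Q p.2.1 ∧ ‖p.2.2‖ ≤ 1 ∧
      b - 2 * ε ≤ RCLike.re (lpDensity μ (lpTail (g p.2.1) M) p.2.2))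
    (fun p q => p.1 < q.1 ∧ p.2.1 < q.2.1 ∧
      ∫ u in ultrafilterHat (largeSet q.2.2), ‖lpTail (g p.2.1) M u‖ ∂μ ≤ w q.1) (by
      intro S _
      set k := S.sup (fun p => p.1) + 1 with hk
      obtain ⟨ρ, hρ, H⟩ : ∃ ρ > 0, ∀ p ∈ S, ∀ E : Set (Ultrafilter Γ), μ.real E ≤ ρ →
          ∫ u in E, ‖lpTail (g p.2.1) M u‖ ∂μ ≤ w k := by
        choose ρ hρ H using fun p : ℕ × ℕ × C(Ultrafilter Γ, 𝕜) => exists_pos_setIntegral_le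
          (lp_two_integrable (lpTail (g p.2.1) M)).norm (hw k)
        obtain ⟨r, hr, hrS⟩ : ∃ r > 0, ∀ p ∈ S, r ≤ ρ p := by
          rcases S.eq_empty_or_nonempty with rfl | hS
          · exact ⟨1, one_pos, by simp⟩
          · exact ⟨S.inf' hS ρ, (Finset.lt_inf'_iff hS).2 fun p _ => hρ p,
              fun p hp => Finset.inf'_le _ hp⟩
        exact ⟨r, hr, fun p hp E hE => H p E (hE.trans (hrS p hp))⟩
      -- Chebyshev contributes ρ/4 and the approximation another ρ/4; `measureReal_hat_largeSet_le`
      -- doubles their sum to ρ.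
      obtain ⟨N, hN⟩ := exists_nat_gt (4 * C / ρ)
      set L := max M (N + 1) with hL
      have hL0 : (0 : ℝ) < L := by positivity
      have hCL : C / L ≤ ρ / 4 := by
        have : (N : ℝ) ≤ L := by exact_mod_cast (Nat.le_succ N).trans (le_max_right _ _)
        rw [div_lt_iff₀ hρ] at hN
        rw [div_le_iff₀ hL0]
        nlinarith
      obtain ⟨j, hQj, hbj, hj⟩ := (hQ.and ((hb L).and ((Filter.eventually_all_finset S).2
        fun p _ => (eventually_gt_atTop p.2.1).filter_mono Nat.hyperfilter_le_atTop))).exists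
      obtain ⟨s, hs1, hs2, hs3⟩ := exists_continuous_concentrated (g j)
        (M := M) (L := L) (by exact_mod_cast le_max_left _ _) (lt_min hε (show 0 < ρ / 4 by linarith))
      refine ⟨⟨k, j, s⟩, ⟨hQj, hs1, ?_⟩, fun p hp => ⟨?_, hj p hp, H p hp _ ?_⟩⟩
      · dsimp only
        linarith [min_le_left ε (ρ / 4)]
      · exact Nat.lt_succ_of_le
          (Finset.le_sup (f := fun p : ℕ × ℕ × C(Ultrafilter Γ, 𝕜) => p.1) hp)
      · have h1 := measureReal_lt_norm_le (g j) hL0 (hC j)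
        refine (measureReal_hat_largeSet_le s).trans ?_
        linarith [min_le_right ε (ρ / 4)])
  refine ⟨fun n => (F n).1, fun n => (F n).2.1, fun n => (F n).2.2, ?_, ?_, fun n => (hP n).1,
    fun n => (hP n).2.1, fun n => (hP n).2.2, fun m n hmn => (hr m n hmn).2.2⟩
  · exact strictMono_nat_of_lt_succ fun n => (hr n (n + 1) n.lt_succ_self).1
  · exact strictMono_nat_of_lt_succ fun n => (hr n (n + 1) n.lt_succ_self).2.1

end Extraction

/-! ### Assembling the norming vector -/

section Norming

variable {𝕜 : Type*} [RCLike 𝕜] {Γ : Type*}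

/-- If a bidual unit vector is uniformly large along a bounded sequence in the dual of
`C(Ultrafilter Γ, 𝕜)`, then so is, along a subsequence, a vector of the unit ball of the space. -/
theorem exists_frequently_le_re_apply {ν : ℕ → StrongDual 𝕜 C(Ultrafilter Γ, 𝕜)} {C : ℝ≥0}
    (hC : ∀ n, ‖ν n‖₊ ≤ C) {φ : StrongDual 𝕜 (StrongDual 𝕜 C(Ultrafilter Γ, 𝕜))}
    (hφ : ‖φ‖ ≤ 1) {c : ℝ}
    (hc : ∀ᶠ j in (hyperfilter ℕ : Filter ℕ), c ≤ RCLike.re (φ (ν j))) {ε : ℝ} (hε : 0 < ε) :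
    ∃ x : C(Ultrafilter Γ, 𝕜), ‖x‖ ≤ 1 ∧ ∃ᶠ j in atTop, c - 21 * ε ≤ RCLike.re (ν j x) := by
  let _ : MeasurableSpace (Ultrafilter Γ) := borel _
  have : BorelSpace (Ultrafilter Γ) := ⟨rfl⟩
  obtain ⟨μ, hμ, hμr, hdom⟩ := exists_regular_measure_dominating ν hC
  choose B hB using hdom
  choose g hg using fun n => exists_lpDensity_eq μ (ν n) (hB n)
  have hgC : ∀ n, ∫ u, ‖g n u‖ ∂μ ≤ C := fun n => by
    refine (integral_norm_le_norm_lpDensity (g n)).trans ?_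
    rw [hg]
    exact hC n
  obtain ⟨M, b, hTM, hTL⟩ := exists_threshold (hyperfilter ℕ)
    (T := fun j M => ∫ u, ‖lpTail (g j) (M : ℝ) u‖ ∂μ)
    (fun j M => integral_nonneg fun u => norm_nonneg _)
    (fun j M => (integral_norm_lpTail_le (g j) M).trans (hgC j)) hε
  obtain ⟨f, hf1, hf⟩ := exists_norming_truncation (g := g) (hyperfilter ℕ) hφ
    (by simpa only [hg] using hc) (Nat.cast_nonneg M) hTM hε
  -- Changing a function in the unit ball on a set of measure η moves the part bounded by M by at
  -- most 2Mη ≤ ε.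
  set η := ε / (2 * M + 1) with hη
  have hM0 : (0 : ℝ) < 2 * M + 1 := by positivity
  have hη0 : 0 < η := by positivity
  have hηM : 2 * M * η + η = ε := by
    rw [hη]; field_simp
  have hM' : 0 ≤ M * η := by positivity
  obtain ⟨w, hw0, d, hwd, hdη⟩ := posSumOfEncodable hη0 ℕ
  have hwη : ∀ F : Finset ℕ, ∑ i ∈ F, w i ≤ η := fun F =>
    (sum_le_hasSum F (fun i _ => (hw0 i).le) hwd).trans hdη
  obtain ⟨k, j, s, hk, hj, hQ, hs1, hs, hsmall⟩ :=
    exists_concentrated_sequence hgC (hTM.and hf) M hε hTL hw0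
  obtain ⟨a, D, ha, hDA, hAD, hD, hm⟩ := exists_disjoint_subsequence
    (τ := fun i A => ∫ u in ultrafilterHat A, ‖lpTail (g (j i)) M u‖ ∂μ)
    (fun i => isFinitelyAdditive_setIntegral (lp_two_integrable _).norm fun u => norm_nonneg _)
    (C := C) (fun i => by
      simpa only [ultrafilterHat_univ, Measure.restrict_univ] using
        (integral_norm_lpTail_le (g (j i)) M).trans (hgC _))
    (A := fun n => largeSet (s n)) (w := fun n => w (k n)) (fun n => hw0 _) (η := η)
    (fun F => by
      rw [← Finset.sum_image (g := k) (f := w) hk.injective.injOn]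
      exact hwη _)
    hsmall (isFinitelyAdditive_measureReal (μ := μ))
  obtain ⟨x, hx1, hxD, hxf⟩ := exists_continuousMap_glue hD (s := fun n => s (a n))
    (fun n => hs1 _) hf1
  -- The bounded part gives at least c - b - 2ε - 2Mη. The tail t has mass at most 6ε off the large
  -- set, so at most 6ε + 2η off D n, and gives at least b - 2ε - 2(6ε + 2η). The total loss is at
  -- most 20ε.
  have key : ∀ n, c - 21 * ε ≤ RCLike.re (ν (j (a n)) x) := by
    intro n
    set t := lpTail (g (j (a n))) M with ht
    have hτ := isFinitelyAdditive_setIntegral (lp_two_integrable t).norm fun u => norm_nonneg _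
    have h1 := norm_lpDensity_sub_le (g (j (a n)) - t) hx1 hf1
      (measurableSet_ultrafilterHat (⋃ n, D n)) hxf
    have h2 : ∫ u in ultrafilterHat (⋃ n, D n), ‖(g (j (a n)) - t) u‖ ∂μ ≤ M * η := by
      refine le_trans ?_ (mul_le_mul_of_nonneg_left hm (Nat.cast_nonneg M))
      calc _ ≤ ∫ u in ultrafilterHat (⋃ n, D n), (M : ℝ) ∂μ :=
            integral_mono_ae (lp_two_integrable _).norm.integrableOn (integrable_const _)
              (ae_restrict_of_ae (norm_sub_lpTail_apply_le _ (Nat.cast_nonneg M)))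
        _ = _ := by simp [mul_comm]
    have h3 := norm_lpDensity_sub_le t hx1 (hs1 (a n))
      (measurableSet_ultrafilterHat (D n)ᶜ) (fun u hu => hxD n u (by
        rwa [ultrafilterHat_compl, Set.notMem_compl_iff] at hu))
    have h4 := re_lpDensity_apply_le t (hs1 (a n))
    have h5 : ∫ u in ultrafilterHat (D n)ᶜ, ‖t u‖ ∂μ ≤
        ∫ u in ultrafilterHat (largeSet (s (a n)))ᶜ, ‖t u‖ ∂μ +
          ∫ u in ultrafilterHat (largeSet (s (a n)) \ D n), ‖t u‖ ∂μ := by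
      refine (hτ.mono fun γ hγ => ?_).trans (hτ.union_le _ _)
      by_cases h : γ ∈ largeSet (s (a n))
      · exact Or.inr ⟨h, hγ⟩
      · exact Or.inl h
    have h6 := hs (a n)
    have h7 := hAD n
    obtain ⟨h8, h9⟩ := hQ (a n)
    have h10 := (RCLike.abs_re_le_norm _).trans h1
    have h11 := (RCLike.abs_re_le_norm _).trans h3
    rw [map_sub, abs_le] at h10 h11
    have h12 : RCLike.re (ν (j (a n)) x) =
        RCLike.re (lpDensity μ (g (j (a n)) - t) x) + RCLike.re (lpDensity μ t x) := by
      rw [← map_add, ← add_apply, ← map_add, sub_add_cancel, hg]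
    simp only [← ht] at h6 h7 h8 h9
    linarith [h10.1, h11.1]
  exact ⟨x, hx1, Filter.frequently_atTop.2 fun N =>
    ⟨j (a N), (hj.comp ha).le_apply, key N⟩⟩

end Norming

/-! ### From C(βΓ) to quotients of ℓ_∞(Γ) -/

section Grothendieck

variable {𝕜 : Type*} [RCLike 𝕜]

theorem mem_closedBall_bidual_iff {X : Type*} [NormedAddCommGroup X] [NormedSpace 𝕜 X]
    {φ : StrongDual 𝕜 (StrongDual 𝕜 X)} :
    φ ∈ Metric.closedBall (0 : StrongDual 𝕜 (StrongDual 𝕜 X)) 1 ↔ ‖φ‖ ≤ 1 :=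
  mem_closedBall_zero_iff (E := StrongDual 𝕜 (StrongDual 𝕜 X))

theorem isQuantGrothendieck_continuousMap_ultrafilter (Γ : Type*) :
    IsQuantGrothendieck 𝕜 1 C(Ultrafilter Γ, 𝕜) := by
  rintro f ⟨C, hC⟩
  rw [ENNReal.coe_one, one_mul]
  refine iSup₂_le fun φ hφ => le_of_forall_lt_imp_le_of_dense fun r hr => ?_
  rw [mem_closedBall_bidual_iff] at hφ
  obtain ⟨r₂, hr2, hr2'⟩ := exists_between hr
  lift r₂ to ℝ≥0 using hr2'.ne_top
  lift r to ℝ≥0 using hr2.ne_top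
  rw [ENNReal.coe_lt_coe] at hr2
  -- Since k n, l n ≥ n, infinitely many good differences at x suffice to bound its oscillation from
  -- below.
  have hex : ∀ n, ∃ k ≥ n, ∃ l ≥ n, (r₂ : ℝ) < ‖φ (f k - f l)‖ := by
    intro n
    have h := hr2'.trans_le (iInf_le _ n)
    simp only [lt_iSup_iff] at h
    obtain ⟨k, hk, l, hl, h⟩ := h
    rw [enorm_eq_nnnorm, ENNReal.coe_lt_coe, ← map_sub] at h
    exact ⟨k, hk, l, hl, h⟩
  choose k hk l hl hkl using hex
  have hν : ∀ n, ‖f (k n) - f (l n)‖ ≤ C + C := fun n =>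
    (norm_sub_le _ _).trans (add_le_add (hC _) (hC _))
  have hC0 : 0 ≤ C + C := (norm_nonneg _).trans (hν 0)
  obtain ⟨z, -, hz⟩ := (isCompact_closedBall (0 : 𝕜) (C + C)).ultrafilter_le_nhds
    ((hyperfilter ℕ).map fun n => φ (f (k n) - f (l n))) (by
      rw [le_principal_iff]
      refine Filter.mem_map.2 (Filter.univ_mem' fun n => mem_closedBall_zero_iff.2 ?_)
      simpa using φ.le_of_opNorm_le_of_le hφ (hν n))
  have hz' : Tendsto (fun n => φ (f (k n) - f (l n))) (hyperfilter ℕ) (𝓝 z) := hz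
  have hz2 : (r₂ : ℝ) ≤ ‖z‖ :=
    ge_of_tendsto hz'.norm (Eventually.of_forall fun n => (hkl n).le)
  obtain ⟨a, ha, ha'⟩ := RCLike.exists_norm_eq_mul_self z
  have hlim := (RCLike.continuous_re.tendsto _).comp (hz'.const_mul a)
  rw [← ha', RCLike.ofReal_re] at hlim
  have hr2R : (r : ℝ) < r₂ := hr2
  have hev : ∀ᶠ n in (hyperfilter ℕ : Filter ℕ),
      ((r : ℝ) + r₂) / 2 ≤ RCLike.re ((a • φ) (f (k n) - f (l n))) :=
    (hlim.eventually (eventually_gt_nhds (show ((r : ℝ) + r₂) / 2 < ‖z‖ by linarith))).mono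
      fun n hn => le_of_lt hn
  obtain ⟨x, hx, hfreq⟩ := exists_frequently_le_re_apply
    (ν := fun n => f (k n) - f (l n)) (C := ⟨C + C, hC0⟩) hν (φ := a • φ)
    (ContinuousLinearMap.opNorm_le_bound _ zero_le_one fun y => by
      rw [smul_apply, norm_smul, ha, one_mul]
      exact φ.le_of_opNorm_le hφ y) hev
    -- With 42 = 2 · 21, the loss 21ε lowers (r + r₂)/2 exactly to r.
    (ε := ((r₂ : ℝ) - r) / 42) (by linarith)
  refine le_trans ?_ (le_iSup₂ x (mem_closedBall_zero_iff.2 hx))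
  refine le_iInf fun n => ?_
  obtain ⟨j, hj, hle⟩ := Filter.frequently_atTop.1 hfreq n
  refine le_trans ?_ (le_iSup₂_of_le (k j) (le_trans hj (hk j))
    (le_iSup₂_of_le (l j) (le_trans hj (hl j)) le_rfl))
  rw [enorm_eq_nnnorm, ENNReal.coe_le_coe, ← NNReal.coe_le_coe, coe_nnnorm]
  have h1 := RCLike.re_le_norm ((f (k j) - f (l j)) x)
  rw [sub_apply] at h1 hle
  linarith

/-- The quantitative Grothendieck property passes to quotients. -/
theorem IsQuantGrothendieck.of_quotientMap {X Y : Type*} [NormedAddCommGroup X] [NormedSpace 𝕜 X]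
    [NormedAddCommGroup Y] [NormedSpace 𝕜 Y] {c : ℝ≥0} (hX : IsQuantGrothendieck 𝕜 c X)
    (q : X →L[𝕜] Y) (hq : ∀ x, ‖q x‖ ≤ ‖x‖)
    (hq' : ∀ y, ‖y‖ < 1 → ∃ x, ‖x‖ ≤ 1 ∧ q x = y) : IsQuantGrothendieck 𝕜 c Y := by
  rintro f ⟨C, hC⟩
  have hq1 : ‖q‖ ≤ 1 := q.opNorm_le_bound zero_le_one (by simpa using hq)
  have hnorm : ∀ g : StrongDual 𝕜 Y, ‖g.comp q‖ = ‖g‖ := by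
    intro g
    refine le_antisymm ?_ (le_of_forall_lt_imp_le_of_dense fun r hr => ?_)
    · exact (g.opNorm_comp_le q).trans (mul_le_of_le_one_right (norm_nonneg _) hq1)
    · obtain ⟨y, hy, hry⟩ := g.exists_lt_apply_of_lt_opNorm hr
      obtain ⟨x, hx, rfl⟩ := hq' y hy
      refine hry.le.trans ?_
      simpa using (g.comp q).le_of_opNorm_le_of_le le_rfl hx
  let T : StrongDual 𝕜 Y →ₗᵢ[𝕜] StrongDual 𝕜 X :=
    { toFun := fun g => g.comp q
      map_add' := fun g h => ContinuousLinearMap.add_comp g h q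
      map_smul' := fun a g => ContinuousLinearMap.smul_comp a g q
      norm_map' := hnorm }
  have hle : deltaW 𝕜 Y f ≤ deltaW 𝕜 X fun n => T (f n) := by
    refine iSup₂_le fun φ hφ => ?_
    rw [mem_closedBall_bidual_iff] at hφ
    -- Hahn–Banach: φ is carried to the range of the isometry T and extended without increasing its
    -- norm.
    obtain ⟨ψ, hψ, hψn⟩ := exists_extension_norm_eq (LinearMap.range T.toLinearMap)
      (φ.comp (T.equivRange.symm.toContinuousLinearEquiv :
        LinearMap.range T.toLinearMap →L[𝕜] StrongDual 𝕜 Y))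
    have hψ' : ∀ g, ψ (T g) = φ g := by
      intro g
      have h1 := hψ (T.equivRange g)
      have h2 : T.equivRange.symm (T.equivRange g) = g := T.equivRange.symm_apply_apply g
      exact h1.trans (congrArg φ h2)
    have hψ1 : ‖ψ‖ ≤ 1 := by
      rw [hψn]
      refine ContinuousLinearMap.opNorm_le_bound _ zero_le_one fun v => ?_
      refine (φ.le_of_opNorm_le hφ _).trans (le_of_eq ?_)
      exact congrArg (1 * ·) (T.equivRange.symm.norm_map v)
    refine le_iSup₂_of_le ψ (mem_closedBall_bidual_iff.2 hψ1) (le_of_eq ?_)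
    simp only [hψ']
  refine hle.trans ((hX _ ⟨C, fun n => (hnorm (f n)).le.trans (hC n)⟩).trans ?_)
  gcongr
  refine iSup₂_le fun x hx => ?_
  rw [mem_closedBall_zero_iff] at hx
  exact le_iSup₂_of_le (q x) (mem_closedBall_zero_iff.2 ((hq x).trans hx)) le_rfl

/-- Restriction of continuous functions on `Ultrafilter Γ` to `Γ`. -/
noncomputable def restrictToLInfty (𝕜 : Type*) [RCLike 𝕜] (Γ : Type*) :
    C(Ultrafilter Γ, 𝕜) →L[𝕜] ℓ^∞(Γ, 𝕜) :=
  LinearMap.mkContinuous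
    { toFun := fun f => ⟨fun γ => f (pure γ), memℓp_infty
        ⟨‖f‖, by rintro _ ⟨γ, rfl⟩; exact f.norm_coe_le_norm _⟩⟩
      map_add' := fun f g => rfl
      map_smul' := fun c f => rfl } 1 (fun f => by
        rw [one_mul]
        exact lp.norm_le_of_forall_le (norm_nonneg _) fun γ => f.norm_coe_le_norm _)

theorem isQuantGrothendieck_lInfty (Γ : Type*) : IsQuantGrothendieck 𝕜 1 ℓ^∞(Γ, 𝕜) := by
  refine (isQuantGrothendieck_continuousMap_ultrafilter Γ).of_quotientMap
    (restrictToLInfty 𝕜 Γ) (fun x => ?_) fun y hy => ?_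
  · exact lp.norm_le_of_forall_le (norm_nonneg _) fun γ => x.norm_coe_le_norm _
  · obtain ⟨x, hx, hx1⟩ := exists_continuousMap_extension (fun γ => y γ)
      (fun γ => lp.norm_apply_le_norm (by simp) y γ) (norm_nonneg y)
    exact ⟨x, hx1.trans hy.le, lp.ext (funext hx)⟩

end Grothendieck

theorem corollary4p4 {𝕜 : Type*} [RCLike 𝕜] (Γ : Type*) (Y : Type*) [NormedAddCommGroup Y]
    [NormedSpace 𝕜 Y] (hY : IsQuotientSpaceOf 𝕜 Y ℓ^∞(Γ, 𝕜)) :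
    IsQuantGrothendieck 𝕜 1 Y := by
  obtain ⟨M, hM, ⟨e⟩⟩ := hY
  let q : ℓ^∞(Γ, 𝕜) →L[𝕜] Y := LinearMap.mkContinuous
    (e.toLinearEquiv.toLinearMap.comp M.mkQ) 1 fun x => by
      rw [one_mul]
      exact (e.norm_map (M.mkQ x)).le.trans (Submodule.Quotient.norm_mk_le M x)
  refine (isQuantGrothendieck_lInfty Γ).of_quotientMap q (fun x => ?_) fun y hy => ?_
  · exact (e.norm_map (M.mkQ x)).le.trans (Submodule.Quotient.norm_mk_le M x)
  · rw [← e.symm.norm_map y] at hy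
    obtain ⟨x, hx, hx1⟩ := Submodule.Quotient.norm_mk_lt (S := M) (e.symm y) (sub_pos.2 hy)
    refine ⟨x, by linarith, ?_⟩
    change e (Submodule.Quotient.mk x) = y
    rw [hx, e.apply_symm_apply]
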